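/- Let $X_0\hookrightarrow X_1\hookrightarrow X_2\hookrightarrow\cdots$ be an inductive system of compact Hausdorff spaces with injective continuous connecting maps, and let $X=\varinjlim_m X_m$ carry the inductive limit topology. For a set $V$ of bounded operators on $\ell^2(\mathbb N)$ let $C(X,V)$ denote the set of norm-continuous functions $f:X\to B(\ell^2(\mathbb N))$ with all values in $V$. Equip $C(X,B(\ell^2(\mathbb N)))$ and the matrix algebras over it with the $C^*$-seminorms $$p_m(f)=\sup_{x\in X_m}\|f(x)\|,\qquad p_m^n([f_{ij}])=\sup_{x\in X_m}\big\|[f_{ij}(x)]\big\|_{M_n(B(\ell^2(\mathbb N)))}.$$ For a local operator system $\mathcal S\subseteq C(X,B(\ell^2(\mathbb N)))$ (a self-adjoint subspace containing the unit) let $\mathcal A=C^*(\mathcal S)$ be the locally $C^*$-algebra generated by $\mathcal S$, that is, the closure, in the topology given by $(p_m)_m$, of the unital $*$-algebra generated by $\mathcal S$. A closed two-sided $*$-ideal $\mathcal I$ of $\mathcal A$ is a boundary ideal for $\mathcal S$ if the canonical map $\mathcal A\to\mathcal A/\mathcal I$ is local completely isometric on $\mathcal S$, that is, for all $n$, $m$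 and all $[s_{ij}]\in M_n(\mathcal S)$, $$\inf\{\,p_m^n([s_{ij}]+[g_{ij}]) : [g_{ij}]\in M_n(\mathcal I)\,\}=p_m^n([s_{ij}]).$$ Let $p\ge 1$ and let $W\in B(\ell^2(\mathbb N))$ be an irreducible periodic unilateral weighted shift of period $p$: $We_n=w_ne_{n+1}$ with $w_{n+p}=w_n$ for all $n$, and no closed subspace other than $0$ and $\ell^2(\mathbb N)$ is invariant under both $W$ and $W^*$. Let $\mathcal S_0=\operatorname{span}\{1,W,W^*\}$ be the operator system generated by $W$, and let $K(\ell^2(\mathbb N))$ be the compact operators. Then $C(X,K(\ell^2(\mathbb N)))$ is a boundary ideal for $C(X,\mathcal S_0)$. -/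

import Mathlib

open CategoryTheory CategoryTheory.Limits

universe u

noncomputable section

section FunctionAlgebra

variable {X : Type*} [TopologicalSpace X] {B : Type*} [CStarAlgebra B]

/-- `C(X, V)` as a set of functions: the continuous `f : X → B` with all values in `V ⊆ B`. -/
def functionsInto (X : Type*) [TopologicalSpace X] (V : Set B) : Set C(X, B) :=
  {f | ∀ x, f x ∈ V}

/-- The C*-seminorm `p_K(f) = sup {‖f x‖ : x ∈ K}` on `C(X, B)`, for `K` compact. -/
def supSeminorm (K : Set X) (f : C(X, B)) : ℝ :=
  sSup ((fun x => ‖f x‖) '' K)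

/-- The closure of `V ⊆ C(X, B)` in the topology defined by the upward filtered (increasing in
`m`) family of seminorms `supSeminorm (K m)`. -/
def seminormClosure (K : ℕ → Set X) (V : Set C(X, B)) : Set C(X, B) :=
  {f | ∀ m : ℕ, ∀ ε : ℝ, 0 < ε → ∃ g ∈ V, supSeminorm (K m) (f - g) < ε}

/-- The unital locally C*-algebra generated by `S` in `C(X, B)`: the closure of the unital
`*`-algebra generated by `S`, for the topology of the seminorms `supSeminorm (K m)`. -/
def generatedLocalCStarAlgebra (K : ℕ → Set X) (S : Set C(X, B)) : Set C(X, B) :=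
  seminormClosure K (StarAlgebra.adjoin ℂ S : Set C(X, B))

/-- `I` is a two-sided `*`-ideal of the `*`-algebra `A`, closed in `A` for the topology of the
seminorms `supSeminorm (K m)`. -/
structure IsClosedTwoSidedStarIdeal (K : ℕ → Set X) (A I : Set C(X, B)) : Prop where
  subset : I ⊆ A
  zero_mem : (0 : C(X, B)) ∈ I
  add_mem : ∀ f ∈ I, ∀ g ∈ I, f + g ∈ I
  smul_mem : ∀ (z : ℂ), ∀ f ∈ I, z • f ∈ I
  mul_mem_left : ∀ a ∈ A, ∀ f ∈ I, a * f ∈ I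
  mul_mem_right : ∀ a ∈ A, ∀ f ∈ I, f * a ∈ I
  star_mem : ∀ f ∈ I, star f ∈ I
  closed : seminormClosure K I ∩ A ⊆ I

variable [PartialOrder B] [StarOrderedRing B]

/-- The C*-seminorm on `M_n(C(X, B)) = C(X, M_n(B))` associated with `supSeminorm K`:
the supremum over `x ∈ K` of the C*-norm of `[f_ij x]` in `M_n(B)`. -/
def matrixSupSeminorm (K : Set X) {n : ℕ} (f : Matrix (Fin n) (Fin n) C(X, B)) : ℝ :=
  sSup ((fun x => ‖CStarMatrix.ofMatrix (f.map fun h => h x)‖) '' K)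

/-- The seminorm of the class of `f` in `M_n(A / I) = M_n(A) / M_n(I)`: the infimum of the
seminorms of `f + g` over all `g ∈ M_n(I)`. -/
def quotientMatrixSeminorm (K : Set X) (I : Set C(X, B)) {n : ℕ}
    (f : Matrix (Fin n) (Fin n) C(X, B)) : ℝ :=
  sInf {r | ∃ g : Matrix (Fin n) (Fin n) C(X, B),
    (∀ i j, g i j ∈ I) ∧ r = matrixSupSeminorm K (f + g)}

/-- `I` is a boundary ideal for the local operator system `S ⊆ C(X, B)`: it is a closed two-sided
`*`-ideal of the locally C*-algebra `A` generated by `S`, and the canonical `*`-homomorphism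
`A → A / I` is local completely isometric on `S`. -/
structure IsBoundaryIdeal (K : ℕ → Set X) (S I : Set C(X, B)) : Prop where
  isClosedTwoSidedStarIdeal :
    IsClosedTwoSidedStarIdeal K (generatedLocalCStarAlgebra K S) I
  completely_isometric : ∀ (n m : ℕ) (s : Matrix (Fin n) (Fin n) C(X, B)),
    (∀ i j, s i j ∈ S) →
      quotientMatrixSeminorm (K m) I s = matrixSupSeminorm (K m) s

end FunctionAlgebra

section WeightedShift

/-- The Hilbert space `ℓ²(ℕ)`. -/
abbrev EllTwo : Type := lp (fun _ : ℕ => ℂ) 2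

/-- `W` is a unilateral weighted shift on `ℓ²(ℕ)` whose weights are periodic with period `p`:
`W e_n = w_n e_{n+1}` and `w_{n+p} = w_n` for all `n`. -/
def IsPeriodicUnilateralWeightedShift (p : ℕ) (W : EllTwo →L[ℂ] EllTwo) : Prop :=
  0 < p ∧ ∃ w : ℕ → ℂ, (∀ n, w (n + p) = w n) ∧
    ∀ n, W (lp.single 2 n (1 : ℂ)) = w n • lp.single 2 (n + 1) (1 : ℂ)

/-- `W` is irreducible: no closed subspace other than `0` and the whole space is invariant under
both `W` and its adjoint. -/
def IsIrreducibleOperator (W : EllTwo →L[ℂ] EllTwo) : Prop :=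
  ∀ M : Submodule ℂ EllTwo, IsClosed (M : Set EllTwo) →
    (∀ v ∈ M, W v ∈ M) → (∀ v ∈ M, ContinuousLinearMap.adjoint W v ∈ M) → M = ⊥ ∨ M = ⊤

/-- The operator system generated by `W`: the smallest self-adjoint subspace of `B(ℓ²(ℕ))` that
contains `1` and `W`, i.e. the linear span of `1`, `W` and `W*`. -/
def operatorSystemGenerated (W : EllTwo →L[ℂ] EllTwo) :
    Submodule ℂ (EllTwo →L[ℂ] EllTwo) :=
  Submodule.span ℂ {1, W, star W}

/-- `K(ℓ²(ℕ))`, the set of compact operators on `ℓ²(ℕ)`. -/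
def compactOperators : Set (EllTwo →L[ℂ] EllTwo) :=
  {T | IsCompactOperator T}

end WeightedShift

end

/-! Irreducibility forces every weight to be nonzero (`weights_ne_zero`), so by periodicity a scalar
multiple `V` of `W ^ p` is the unweighted shift by `p` places: a pure isometry that commutes with
`W`. Hence `V* W V = V* V W = W`, and compression by `V` fixes `1`, `W` and `W*`. Iterated
compression sends every compact operator to zero in norm. Compressing `s + g` by `V ^ k`, with `s` a
matrix over the operator system and `g` a compact one, therefore gives a sequence of norm at most
`‖s + g‖` that converges to `s`, so `‖s‖ ≤ ‖s + g‖` (`norm_le_norm_add_of_compact`). Applied at each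
point, this shows that the infimum in the quotient seminorm is attained at `g = 0`.

The other issue is that compact-valued functions lie in the generated algebra. All matrix units are
polynomials in `W` and `W*` (`matrixUnit_mem_adjoin`). On a compact piece a compact-valued function
has norm-compact image, so one finite corner approximates it uniformly
(`exists_corner_approximation`), and that corner is a finite sum of scalar functions times matrix
units. -/

open Filter Topology

/-! ### Isometries in a C*-algebra -/

section Isometry

variable {A : Type*} [CStarAlgebra A] {v : A}

lemma norm_le_one_of_star_mul_self_eq_one (h : star v * v = 1) : ‖v‖ ≤ 1 := by
  have h1 : ‖v‖ * ‖v‖ ≤ 1 := by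
    rw [← CStarRing.norm_star_mul_self, h]
    exact IsStarProjection.norm_le _ (IsStarProjection.one _)
  nlinarith [norm_nonneg v]

lemma norm_star_le_one_of_star_mul_self_eq_one (h : star v * v = 1) : ‖star v‖ ≤ 1 :=
  (norm_star v).trans_le (norm_le_one_of_star_mul_self_eq_one h)

end Isometry

/-! ### Pure isometries acting on compact operators -/

section CompactOperators

variable {H : Type*} [NormedAddCommGroup H] [InnerProductSpace ℂ H] [CompleteSpace H]

omit [CompleteSpace H] in
/-- Contractions converging strongly to zero converge uniformly to zero after composition with a
compact operator. -/
lemma IsCompactOperator.tendsto_mul_zero {Z : ℕ → H →L[ℂ] H} {T : H →L[ℂ] H}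
    (hT : IsCompactOperator T) (hZ : ∀ k, ‖Z k‖ ≤ 1)
    (h : ∀ v, Tendsto (fun k => Z k v) atTop (𝓝 0)) :
    Tendsto (fun k => Z k * T) atTop (𝓝 0) := by
  rw [NormedAddGroup.tendsto_nhds_zero]
  intro ε hε
  have hC : IsCompact (closure (T '' Metric.closedBall 0 1)) :=
    IsCompactOperator.isCompact_closure_image_closedBall (f := (T : H →ₗ[ℂ] H)) hT 1
  -- The image of the unit ball is totally bounded, so strong convergence is needed only at finitely
  -- many centres.
  obtain ⟨t, -, htf, hcov⟩ := hC.finite_cover_balls (e := ε / 4) (by positivity)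
  have hev : ∀ᶠ k in atTop, ∀ y ∈ t, ‖Z k y‖ < ε / 4 := by
    rw [htf.eventually_all]
    intro y _
    exact (NormedAddGroup.tendsto_nhds_zero.1 (h y)) _ (by positivity)
  filter_upwards [hev] with k hk
  refine lt_of_le_of_lt (?_ : _ ≤ ε / 2) (by linarith)
  refine ContinuousLinearMap.opNorm_le_of_unit_norm (by positivity) fun v hv => ?_
  have hmem : T v ∈ closure (T '' Metric.closedBall 0 1) :=
    subset_closure ⟨v, by simp [hv], rfl⟩
  obtain ⟨y, hy, hyv⟩ := Set.mem_iUnion₂.1 (hcov hmem)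
  rw [Metric.mem_ball, dist_eq_norm] at hyv
  calc ‖Z k (T v)‖ = ‖Z k (T v - y) + Z k y‖ := by rw [map_sub, sub_add_cancel]
    _ ≤ ‖Z k (T v - y)‖ + ‖Z k y‖ := norm_add_le _ _
    _ ≤ ‖T v - y‖ + ‖Z k y‖ := by
        gcongr
        exact ((Z k).le_of_opNorm_le (hZ k) _).trans_eq (one_mul _)
    _ ≤ ε / 2 := by linarith [hk y hy]

omit [CompleteSpace H] in
lemma isCompactOperator_rankOne (x y : H) :
    IsCompactOperator (InnerProductSpace.rankOne ℂ x y) := by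
  rw [InnerProductSpace.rankOne_def']
  exact (isCompactOperator_of_locallyCompactSpace_rng
    (ContinuousLinearMap.toSpanSingleton ℂ x)).comp_clm _

/-- An isometry whose adjoint powers converge strongly to zero, and for which the projections onto
the orthogonal complements of the ranges of its powers are compact. -/
structure IsPureIsometry (V : H →L[ℂ] H) : Prop where
  star_mul_self : star V * V = 1
  tendsto_zero : ∀ v, Tendsto (fun k : ℕ => (star V ^ k) v) atTop (𝓝 0)
  isCompactOperator : ∀ k : ℕ, IsCompactOperator (1 - V ^ k * star V ^ k : H →L[ℂ] H)

/-- The projection onto the orthogonal complement of the range of `V ^ k`. -/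
noncomputable def wanderingProjection (V : H →L[ℂ] H) (k : ℕ) : H →L[ℂ] H :=
  1 - V ^ k * star V ^ k

namespace IsPureIsometry

variable {V : H →L[ℂ] H} (hV : IsPureIsometry V)
include hV

lemma star_pow_mul_pow (k : ℕ) : star V ^ k * V ^ k = 1 := by
  induction k with
  | zero => simp
  | succ k ih =>
    rw [pow_succ, pow_succ', mul_assoc, ← mul_assoc (star V) V, hV.star_mul_self, one_mul, ih]

lemma isStarProjection (k : ℕ) : IsStarProjection (wanderingProjection V k) := by
  refine IsStarProjection.one_sub ⟨?_, ?_⟩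
  · rw [IsIdempotentElem, mul_assoc, ← mul_assoc (star V ^ k) (V ^ k), hV.star_pow_mul_pow, one_mul]
  · rw [isSelfAdjoint_iff, star_mul, star_pow, star_pow, star_star]

lemma norm_pow_le (k : ℕ) : ‖V ^ k‖ ≤ 1 :=
  norm_le_one_of_star_mul_self_eq_one (by rw [star_pow, hV.star_pow_mul_pow])

lemma norm_star_pow_le (k : ℕ) : ‖star V ^ k‖ ≤ 1 := by
  rw [← star_pow]
  exact norm_star_le_one_of_star_mul_self_eq_one (by rw [star_pow, hV.star_pow_mul_pow])

/-- The error is `V ^ k * (V*) ^ k * T`, and `(V*) ^ k * T` already tends to zero in norm. -/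
lemma tendsto_wanderingProjection_mul {T : H →L[ℂ] H} (hT : IsCompactOperator T) :
    Tendsto (fun k => wanderingProjection V k * T) atTop (𝓝 T) := by
  have h0 := (hT.tendsto_mul_zero hV.norm_star_pow_le hV.tendsto_zero)
  have h1 : Tendsto (fun k => V ^ k * (star V ^ k * T)) atTop (𝓝 0) := by
    refine squeeze_zero_norm (fun k => ?_) (tendsto_zero_iff_norm_tendsto_zero.1 h0)
    refine (norm_mul_le _ _).trans ?_
    exact mul_le_of_le_one_left (norm_nonneg _) (hV.norm_pow_le k)
  have h2 := h1.const_sub T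
  rw [sub_zero] at h2
  refine h2.congr fun k => ?_
  rw [wanderingProjection, sub_mul, one_mul, mul_assoc]

/-- Schauder's theorem in this setting: `T*` is the norm limit of the operators `T* Q_k`, where the
wandering projections `Q_k` are compact. -/
lemma isCompactOperator_star {T : H →L[ℂ] H} (hT : IsCompactOperator T) :
    IsCompactOperator (star T : H →L[ℂ] H) := by
  have h : Tendsto (fun k => star T * wanderingProjection V k) atTop (𝓝 (star T)) := by
    refine (hV.tendsto_wanderingProjection_mul hT).star.congr fun k => ?_
    rw [star_mul, (hV.isStarProjection k).isSelfAdjoint.star_eq]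
  refine isClosed_setOfPred_isCompactOperator.mem_of_tendsto h (Eventually.of_forall fun k => ?_)
  exact (hV.isCompactOperator k).clm_comp (star T)

lemma tendsto_mul_wanderingProjection {T : H →L[ℂ] H} (hT : IsCompactOperator T) :
    Tendsto (fun k => T * wanderingProjection V k) atTop (𝓝 T) := by
  have h := (hV.tendsto_wanderingProjection_mul (hV.isCompactOperator_star hT)).star
  rw [star_star] at h
  refine h.congr fun k => ?_
  rw [star_mul, (hV.isStarProjection k).isSelfAdjoint.star_eq, star_star]

lemma tendsto_corner {T : H →L[ℂ] H} (hT : IsCompactOperator T) :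
    Tendsto (fun k => wanderingProjection V k * T * wanderingProjection V k) atTop (𝓝 T) := by
  have h1 := hV.tendsto_wanderingProjection_mul hT
  have h2 : Tendsto (fun k => T * wanderingProjection V k - T) atTop (𝓝 0) := by
    simpa using (hV.tendsto_mul_wanderingProjection hT).sub_const T
  have h3 : Tendsto (fun k => wanderingProjection V k * (T * wanderingProjection V k - T))
      atTop (𝓝 0) := by
    refine squeeze_zero_norm (fun k => ?_) (tendsto_zero_iff_norm_tendsto_zero.1 h2)
    refine (norm_mul_le _ _).trans ?_
    exact mul_le_of_le_one_left (norm_nonneg _) (IsStarProjection.norm_le _ (hV.isStarProjection k))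
  have h4 := h3.add h1
  rw [zero_add] at h4
  refine h4.congr fun k => ?_
  rw [mul_sub, sub_add_cancel, mul_assoc]

/-- Compressions to the wandering subspaces converge uniformly on norm-compact sets of compact
operators. -/
lemma exists_corner_approximation {C : Set (H →L[ℂ] H)} (hC : IsCompact C)
    (hcomp : ∀ T ∈ C, IsCompactOperator T) {ε : ℝ} (hε : 0 < ε) :
    ∃ k, ∀ T ∈ C, ‖T - wanderingProjection V k * T * wanderingProjection V k‖ ≤ ε := by
  obtain ⟨t, htC, htf, hcov⟩ := hC.finite_cover_balls (e := ε / 4) (by positivity)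
  have hev : ∀ᶠ k in atTop, ∀ S ∈ t,
      ‖wanderingProjection V k * S * wanderingProjection V k - S‖ < ε / 4 := by
    rw [htf.eventually_all]
    intro S hS
    have h := (hV.tendsto_corner (hcomp S (htC hS))).sub_const S
    rw [sub_self] at h
    exact NormedAddGroup.tendsto_nhds_zero.1 h _ (by positivity)
  obtain ⟨k, hk⟩ := hev.exists
  refine ⟨k, fun T hT => ?_⟩
  obtain ⟨S, hS, hTS⟩ := Set.mem_iUnion₂.1 (hcov hT)
  rw [Metric.mem_ball, dist_eq_norm] at hTS
  have hkS := hk S hS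
  have hQ := IsStarProjection.norm_le _ (hV.isStarProjection k)
  set Q := wanderingProjection V k
  have hcontr : ‖Q * (T - S) * Q‖ ≤ ‖T - S‖ :=
    calc ‖Q * (T - S) * Q‖ ≤ ‖Q‖ * ‖T - S‖ * ‖Q‖ :=
          (norm_mul_le _ _).trans (mul_le_mul_of_nonneg_right (norm_mul_le _ _) (norm_nonneg _))
      _ ≤ 1 * ‖T - S‖ * 1 := by gcongr
      _ = ‖T - S‖ := by ring
  calc ‖T - Q * T * Q‖ = ‖(T - S) - (Q * S * Q - S) - Q * (T - S) * Q‖ := by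
        congr 1; noncomm_ring
    _ ≤ ‖T - S‖ + ‖Q * S * Q - S‖ + ‖Q * (T - S) * Q‖ :=
        (norm_sub_le _ _).trans (by gcongr; exact norm_sub_le _ _)
    _ ≤ ε := by linarith

lemma tendsto_compression_zero {T : H →L[ℂ] H} (hT : IsCompactOperator T) :
    Tendsto (fun k => star V ^ k * T * V ^ k) atTop (𝓝 0) := by
  refine squeeze_zero_norm (fun k => ?_) (tendsto_zero_iff_norm_tendsto_zero.1
    (hT.tendsto_mul_zero hV.norm_star_pow_le hV.tendsto_zero))
  refine (norm_mul_le _ _).trans ?_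
  exact mul_le_of_le_one_right (norm_nonneg _) (hV.norm_pow_le k)

omit hV in
lemma compression_pow_eq {T : H →L[ℂ] H} (hT : star V * T * V = T) (k : ℕ) :
    star V ^ k * T * V ^ k = T := by
  induction k with
  | zero => simp
  | succ k ih =>
    calc star V ^ (k + 1) * T * V ^ (k + 1) = star V ^ k * (star V * T * V) * V ^ k := by
          rw [pow_succ, pow_succ']; simp only [mul_assoc]
      _ = T := by rw [hT, ih]

/-- Operator matrices whose entries are fixed by the compression by a pure isometry have norm
equal to their essential norm. -/
lemma norm_le_norm_add_of_compact {n : ℕ} (s g : Matrix (Fin n) (Fin n) (H →L[ℂ] H))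
    (hs : ∀ i j, star V * s i j * V = s i j) (hg : ∀ i j, IsCompactOperator (g i j)) :
    ‖CStarMatrix.ofMatrix s‖ ≤ ‖CStarMatrix.ofMatrix (s + g)‖ := by
  -- The diagonal amplification of `V ^ k` is an isometry, so conjugation by it is contractive on
  -- matrices and acts entrywise as compression.
  let D : ℕ → CStarMatrix (Fin n) (Fin n) (H →L[ℂ] H) := fun k =>
    CStarMatrix.ofMatrix (Matrix.diagonal fun _ => V ^ k)
  have hstarD : ∀ k, star (D k) = CStarMatrix.ofMatrix (Matrix.diagonal fun _ => star V ^ k) := by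
    intro k
    ext1 i j
    simp [D, CStarMatrix.star_apply, Matrix.diagonal_apply, apply_ite star, eq_comm]
  have hconj : ∀ k (a : Matrix (Fin n) (Fin n) (H →L[ℂ] H)),
      star (D k) * CStarMatrix.ofMatrix a * D k =
        CStarMatrix.ofMatrix (a.map fun b => star V ^ k * b * V ^ k) := by
    intro k a
    rw [hstarD]
    ext1 i j
    simp [D, CStarMatrix.mul_apply, Matrix.diagonal_apply]
  have hDD : ∀ k, star (D k) * D k = 1 := by
    intro k
    rw [hstarD]
    ext1 i j
    simp [D, CStarMatrix.mul_apply, Matrix.diagonal_apply, CStarMatrix.one_apply,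
      hV.star_pow_mul_pow]
  have hle : ∀ k, ‖CStarMatrix.ofMatrix ((s + g).map fun b => star V ^ k * b * V ^ k)‖ ≤
      ‖CStarMatrix.ofMatrix (s + g)‖ := by
    intro k
    rw [← hconj]
    calc _ ≤ ‖star (D k)‖ * ‖CStarMatrix.ofMatrix (s + g)‖ * ‖D k‖ :=
          (norm_mul_le _ _).trans (mul_le_mul_of_nonneg_right (norm_mul_le _ _) (norm_nonneg _))
      _ ≤ 1 * ‖CStarMatrix.ofMatrix (s + g)‖ * 1 := by
          gcongr
          · exact norm_star_le_one_of_star_mul_self_eq_one (hDD k)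
          · exact norm_le_one_of_star_mul_self_eq_one (hDD k)
      _ = _ := by ring
  have hlim : Tendsto (fun k => CStarMatrix.ofMatrix
      ((s + g).map fun b => star V ^ k * b * V ^ k)) atTop (𝓝 (CStarMatrix.ofMatrix s)) := by
    refine tendsto_pi_nhds.2 fun i => tendsto_pi_nhds.2 fun j => ?_
    have h := (hV.tendsto_compression_zero (hg i j)).const_add (s i j)
    rw [add_zero] at h
    refine h.congr fun k => ?_
    change _ = star V ^ k * (s i j + g i j) * V ^ k
    rw [mul_add, add_mul, compression_pow_eq (hs i j)]
  exact le_of_tendsto hlim.norm (Eventually.of_forall hle)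

end IsPureIsometry

end CompactOperators

/-! ### Matrix units and unweighted shifts on ℓ²(ℕ) -/

namespace EllTwo

/-- The standard basis vectors of `ℓ²(ℕ)`. -/
noncomputable def basisVector (n : ℕ) : EllTwo := lp.single 2 n (1 : ℂ)

/-- The standard matrix units on `ℓ²(ℕ)`. -/
noncomputable def matrixUnit (i j : ℕ) : EllTwo →L[ℂ] EllTwo :=
  InnerProductSpace.rankOne ℂ (basisVector i) (basisVector j)

lemma basisVector_apply (n m : ℕ) : basisVector n m = if m = n then 1 else 0 := by
  rw [basisVector, lp.single_apply, Pi.single_apply]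

lemma inner_basisVector (n : ℕ) (v : EllTwo) : inner ℂ (basisVector n) v = v n := by
  rw [basisVector, lp.inner_single_left]
  simp

lemma hasSum_basisVector (v : EllTwo) : HasSum (fun n => v n • basisVector n) v := by
  convert lp.hasSum_single ENNReal.ofNat_ne_top v using 2 with n
  rw [basisVector, ← lp.single_smul, smul_eq_mul, mul_one]

lemma ext_basisVector {S T : EllTwo →L[ℂ] EllTwo}
    (h : ∀ n, S (basisVector n) = T (basisVector n)) : S = T := by
  ext1 v
  have hS := S.hasSum (hasSum_basisVector v)
  have hT := T.hasSum (hasSum_basisVector v)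
  simp only [map_smul, h] at hS hT
  exact hS.unique hT

lemma star_apply_coord (T : EllTwo →L[ℂ] EllTwo) (v : EllTwo) (n : ℕ) :
    (star T v) n = inner ℂ (T (basisVector n)) v := by
  rw [← inner_basisVector, ContinuousLinearMap.star_eq_adjoint,
    ContinuousLinearMap.adjoint_inner_right]

lemma matrixUnit_mul_mul (T : EllTwo →L[ℂ] EllTwo) (i j : ℕ) :
    matrixUnit i i * T * matrixUnit j j = (T (basisVector j) i) • matrixUnit i j := by
  ext1 v
  simp only [matrixUnit, mul_apply_eq_comp, InnerProductSpace.rankOne_apply,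
    smul_apply, map_smul, inner_basisVector, smul_smul]
  rw [mul_comm]

section IsometricShift

variable {V : EllTwo →L[ℂ] EllTwo} {N : ℕ} (hV : ∀ n, V (basisVector n) = basisVector (n + N))
include hV

lemma star_shift_apply_coord (v : EllTwo) (n : ℕ) : (star V v) n = v (n + N) := by
  rw [star_apply_coord, hV, inner_basisVector]

lemma star_shift_mul_shift : star V * V = 1 := by
  refine ext_basisVector fun n => ?_
  ext m
  rw [mul_apply_eq_comp, star_shift_apply_coord hV, hV]
  simp [basisVector_apply]

lemma shift_pow_apply (k n : ℕ) : (V ^ k) (basisVector n) = basisVector (n + k * N) := by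
  induction k generalizing n with
  | zero => simp
  | succ k ih =>
    rw [pow_succ, mul_apply_eq_comp, hV, ih]
    congr 1
    ring

lemma one_sub_shift_mul_star_shift :
    1 - V * star V = ∑ i ∈ Finset.range N, matrixUnit i i := by
  refine ext_basisVector fun j => ?_
  have hsum : (∑ i ∈ Finset.range N, matrixUnit i i) (basisVector j) =
      if j < N then basisVector j else 0 := by
    rw [sum_apply]
    simp only [matrixUnit, InnerProductSpace.rankOne_apply, inner_basisVector, basisVector_apply,
      ite_smul, one_smul, zero_smul, Finset.sum_ite_eq', Finset.mem_range]
  rw [hsum, sub_apply, one_apply_eq_self,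
    mul_apply_eq_comp]
  split_ifs with h
  · have h0 : star V (basisVector j) = 0 := by
      ext m
      rw [star_shift_apply_coord hV, basisVector_apply, if_neg (by omega)]
      rfl
    rw [h0, map_zero, sub_zero]
  · obtain ⟨n, rfl⟩ := Nat.exists_eq_add_of_le' (not_lt.1 h)
    have h1 : star V (basisVector (n + N)) = basisVector n := by
      rw [← hV, ← mul_apply_eq_comp, star_shift_mul_shift hV,
        one_apply_eq_self]
    rw [h1, hV, sub_self]

lemma wanderingProjection_shift (k : ℕ) :
    wanderingProjection V k = ∑ i ∈ Finset.range (k * N), matrixUnit i i := by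
  rw [wanderingProjection, ← star_pow, one_sub_shift_mul_star_shift (shift_pow_apply hV k)]

lemma isPureIsometry_shift (hN : 0 < N) : IsPureIsometry V where
  star_mul_self := star_shift_mul_shift hV
  isCompactOperator k := by
    change IsCompactOperator (wanderingProjection V k)
    rw [wanderingProjection_shift hV]
    exact (compactOperator (RingHom.id ℂ) EllTwo EllTwo).sum_mem
      fun i _ => isCompactOperator_rankOne _ _
  tendsto_zero v := by
    have hsum := ((hasSum_basisVector v).tendsto_sum_nat.comp
      (tendsto_id.atTop_mul_const' hN)).const_sub v
    rw [sub_self] at hsum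
    refine squeeze_zero_norm (fun k => ?_) (tendsto_zero_iff_norm_tendsto_zero.1 hsum)
    -- The tail of the basis expansion is `V ^ k (V*) ^ k v`; applying the contraction `(V*) ^ k`
    -- bounds `(V*) ^ k v` by that tail.
    have h1 : v - ∑ i ∈ Finset.range (k * N), v i • basisVector i =
        (V ^ k) ((star V ^ k) v) := by
      have h := congrArg (fun T => T v) (wanderingProjection_shift hV k)
      simp only [sum_apply, matrixUnit, InnerProductSpace.rankOne_apply,
        inner_basisVector] at h
      rw [← h, wanderingProjection, sub_apply, one_apply_eq_self,
        mul_apply_eq_comp, sub_sub_cancel]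
    have h2 : (star V ^ k) ((V ^ k) ((star V ^ k) v)) = (star V ^ k) v := by
      have := star_shift_mul_shift (shift_pow_apply hV k)
      rw [star_pow] at this
      rw [← mul_apply_eq_comp, this, one_apply_eq_self]
    have h3 : ‖star V ^ k‖ ≤ 1 := by
      rw [← star_pow]
      exact norm_star_le_one_of_star_mul_self_eq_one (star_shift_mul_shift (shift_pow_apply hV k))
    calc ‖(star V ^ k) v‖ = ‖(star V ^ k) ((V ^ k) ((star V ^ k) v))‖ := by rw [h2]
      _ ≤ ‖(V ^ k) ((star V ^ k) v)‖ :=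
        ((star V ^ k).le_of_opNorm_le h3 _).trans_eq (one_mul _)
      _ = _ := by rw [← h1]; rfl

/-- The matrix expansion of the compression of `T` to the first `k * N` basis vectors. -/
lemma corner_eq_sum (k : ℕ) (T : EllTwo →L[ℂ] EllTwo) :
    wanderingProjection V k * T * wanderingProjection V k =
      ∑ i ∈ Finset.range (k * N), ∑ j ∈ Finset.range (k * N),
        (T (basisVector j) i) • matrixUnit i j := by
  rw [wanderingProjection_shift hV]
  simp only [Finset.sum_mul, Finset.mul_sum, matrixUnit_mul_mul]
  exact Finset.sum_comm

end IsometricShift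

/-! ### Weighted shifts -/

section WeightedShift

variable {W : EllTwo →L[ℂ] EllTwo} {w : ℕ → ℂ}
  (hW : ∀ n, W (basisVector n) = w n • basisVector (n + 1))
include hW

lemma star_weightedShift_apply_coord (v : EllTwo) (n : ℕ) :
    (star W v) n = star (w n) * v (n + 1) := by
  rw [star_apply_coord, hW, inner_smul_left, inner_basisVector]
  rfl

lemma star_weightedShift_basisVector_succ (n : ℕ) :
    star W (basisVector (n + 1)) = star (w n) • basisVector n := by
  ext m
  rw [star_weightedShift_apply_coord hW, basisVector_apply, lp.coeFn_smul, Pi.smul_apply,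
    basisVector_apply]
  by_cases h : m = n
  · simp [h]
  · simp [h]

lemma weightedShift_apply_succ (v : EllTwo) (n : ℕ) : (W v) (n + 1) = w n * v n := by
  have h := star_apply_coord (star W) v (n + 1)
  rw [star_star, star_weightedShift_basisVector_succ hW, inner_smul_left, inner_basisVector] at h
  simpa using h

/-- A zero weight `w n` would make the span of `e_0, ..., e_n` reducing; it contains `e_n` but not
`e_{n+1}`. -/
lemma weights_ne_zero (hirr : IsIrreducibleOperator W) (n : ℕ) : w n ≠ 0 := by
  intro hn
  -- Written as an intersection of orthogonal complements, this span is visibly closed and is tested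
  -- by coordinates.
  let M : Submodule ℂ EllTwo := ⨅ k ∈ Set.Ioi n, (ℂ ∙ basisVector k)ᗮ
  have hmem : ∀ v, v ∈ M ↔ ∀ k, n < k → v k = 0 := by
    intro v
    simp only [M, Submodule.mem_iInf, Submodule.mem_orthogonal_singleton_iff_inner_right,
      inner_basisVector, Set.mem_Ioi]
  have hclosed : IsClosed (M : Set EllTwo) := by
    simp only [M, Submodule.coe_iInf]
    exact isClosed_biInter fun k _ => Submodule.isClosed_orthogonal _
  have hinv : ∀ v ∈ M, W v ∈ M := by
    refine fun v hv => (hmem _).2 fun k hk => ?_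
    obtain ⟨k, rfl⟩ := Nat.exists_eq_add_of_le' (Nat.one_le_of_lt hk)
    rw [weightedShift_apply_succ hW]
    rcases (Nat.lt_succ_iff.1 hk).eq_or_lt with rfl | h
    · rw [hn, zero_mul]
    · rw [(hmem v).1 hv k h, mul_zero]
  have hinv_star : ∀ v ∈ M, ContinuousLinearMap.adjoint W v ∈ M := by
    refine fun v hv => (hmem _).2 fun k hk => ?_
    rw [← ContinuousLinearMap.star_eq_adjoint, star_weightedShift_apply_coord hW,
      (hmem v).1 hv (k + 1) (by omega), mul_zero]
  rcases hirr M hclosed hinv hinv_star with h | h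
  · have h1 : basisVector n ∈ M := (hmem _).2 fun k hk => by
      rw [basisVector_apply, if_neg hk.ne']
    rw [h, Submodule.mem_bot] at h1
    have h2 := basisVector_apply n n
    rw [h1] at h2
    simp at h2
  · have h1 : basisVector (n + 1) ∈ M := h ▸ Submodule.mem_top
    have h2 := (hmem _).1 h1 (n + 1) (Nat.lt_succ_self n)
    simp [basisVector_apply] at h2

lemma weightedShift_pow_apply (k n : ℕ) :
    (W ^ k) (basisVector n) = (∏ i ∈ Finset.range k, w (n + i)) • basisVector (n + k) := by
  induction k with
  | zero => simp
  | succ k ih =>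
    rw [pow_succ', mul_apply_eq_comp, ih, map_smul, hW, smul_smul,
      Finset.prod_range_succ, add_assoc]

lemma star_weightedShift_pow_apply_coord (k : ℕ) (v : EllTwo) (n : ℕ) :
    ((star W ^ k) v) n = star (∏ i ∈ Finset.range k, w (n + i)) * v (n + k) := by
  rw [← star_pow, star_apply_coord, weightedShift_pow_apply hW, inner_smul_left,
    inner_basisVector]
  rfl

/-- The isometric shift by one period is a multiple of a power of the weighted shift. -/
lemma normalized_weightedShift_pow_apply {p : ℕ} (hper : ∀ n, w (n + p) = w n)
    (hw : ∀ n, w n ≠ 0) (n : ℕ) :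
    ((∏ i ∈ Finset.range p, w i)⁻¹ • W ^ p) (basisVector n) = basisVector (n + p) := by
  -- Moving the window by one replaces the factor `w n` by `w (n + p)`, which equals it.
  have hprod : ∏ i ∈ Finset.range p, w (n + i) = ∏ i ∈ Finset.range p, w i := by
    induction n with
    | zero => simp
    | succ n ih =>
      rw [← ih]
      refine mul_right_cancel₀ (hw n) ?_
      have h1 := Finset.prod_range_succ (fun i => w (n + i)) p
      have h2 := Finset.prod_range_succ' (fun i => w (n + i)) p
      rw [h2, hper] at h1
      simpa [add_assoc, add_comm 1] using h1
  rw [smul_apply, weightedShift_pow_apply hW, hprod, smul_smul,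
    inv_mul_cancel₀ (Finset.prod_ne_zero_iff.2 fun i _ => hw i), one_smul]

/-- The defect `1 - V V*` is the projection onto the first `p` basis vectors. Conjugating it with `p
- 1` backward shifts leaves a nonzero multiple of `E_00`, and `W ^ i E_00 (W*) ^ j` is a nonzero
multiple of `E_ij`. -/
lemma matrixUnit_mem_adjoin {p : ℕ} (hp : 0 < p) (hper : ∀ n, w (n + p) = w n)
    (hw : ∀ n, w n ≠ 0) (i j : ℕ) : matrixUnit i j ∈ StarAlgebra.adjoin ℂ {W} := by
  set A := StarAlgebra.adjoin ℂ {W}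
  have hWA : W ∈ A := StarAlgebra.self_mem_adjoin_singleton ℂ W
  have hstarWA : star W ∈ A := star_mem hWA
  have hVA : (∏ i ∈ Finset.range p, w i)⁻¹ • W ^ p ∈ A := A.smul_mem (pow_mem hWA p) _
  have hV := normalized_weightedShift_pow_apply hW hper hw
  set V := (∏ i ∈ Finset.range p, w i)⁻¹ • W ^ p
  have hQ : ∑ i ∈ Finset.range p, matrixUnit i i ∈ A := by
    rw [← one_sub_shift_mul_star_shift hV]
    exact sub_mem (one_mem _) (mul_mem hVA (star_mem hVA))
  have hprod : ∀ k, ∏ i ∈ Finset.range k, w (0 + i) ≠ 0 := fun k =>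
    Finset.prod_ne_zero_iff.2 fun i _ => hw _
  have h00 : matrixUnit 0 0 ∈ A := by
    -- Here `m = p - 1`: `(W*) ^ m` kills `e_i` for `i < m` and sends `e_m` to a multiple of `e_0`.
    obtain ⟨m, rfl⟩ := Nat.exists_eq_add_of_le' hp
    have hmem := mul_mem (mul_mem (pow_mem hstarWA m) hQ) (pow_mem hWA m)
    set c := star (∏ l ∈ Finset.range m, w (0 + l))
    have hc : c ≠ 0 := star_ne_zero.2 (hprod m)
    have hterm : ∀ i, star W ^ m * matrixUnit i i * W ^ m =
        InnerProductSpace.rankOne ℂ ((star W ^ m) (basisVector i))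
          ((star W ^ m) (basisVector i)) := by
      intro i
      rw [matrixUnit, ContinuousLinearMap.mul_def, ContinuousLinearMap.mul_def,
        InnerProductSpace.comp_rankOne, InnerProductSpace.rankOne_comp,
        ← ContinuousLinearMap.star_eq_adjoint, star_pow]
    have hlow : ∀ i ∈ Finset.range m, star W ^ m * matrixUnit i i * W ^ m = 0 := by
      intro i hi
      have h0 : (star W ^ m) (basisVector i) = 0 := by
        ext k
        have := Finset.mem_range.1 hi
        rw [star_weightedShift_pow_apply_coord hW, basisVector_apply, if_neg (by omega), mul_zero]
        rfl
      rw [hterm, h0, map_zero]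
    have htop : (star W ^ m) (basisVector m) = c • basisVector 0 := by
      ext k
      rw [star_weightedShift_pow_apply_coord hW, basisVector_apply, lp.coeFn_smul, Pi.smul_apply,
        basisVector_apply]
      by_cases h : k = 0
      · subst h
        simp [c]
      · simp [h]
    rw [Finset.mul_sum, Finset.sum_mul, Finset.sum_range_succ, Finset.sum_eq_zero hlow, zero_add,
      hterm, htop, map_smulₛₗ, map_smul, smul_apply, smul_smul] at hmem
    have h := A.smul_mem hmem (starRingEnd ℂ c * c)⁻¹
    rwa [smul_smul, inv_mul_cancel₀ (mul_ne_zero ((map_ne_zero _).2 hc) hc), one_smul] at h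
  have hij : W ^ i * matrixUnit 0 0 * star W ^ j ∈ A :=
    mul_mem (mul_mem (pow_mem hWA i) h00) (pow_mem hstarWA j)
  have heq : W ^ i * matrixUnit 0 0 * star W ^ j =
      ((∏ l ∈ Finset.range i, w (0 + l)) * star (∏ l ∈ Finset.range j, w (0 + l))) •
        matrixUnit i j := by
    rw [matrixUnit, ContinuousLinearMap.mul_def, ContinuousLinearMap.mul_def,
      InnerProductSpace.comp_rankOne, InnerProductSpace.rankOne_comp,
      ← ContinuousLinearMap.star_eq_adjoint, star_pow, star_star, weightedShift_pow_apply hW,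
      weightedShift_pow_apply hW, map_smulₛₗ, map_smul, smul_apply, smul_smul, zero_add, zero_add,
      mul_comm]
    rfl
  rw [heq] at hij
  have h := A.smul_mem hij
    ((∏ l ∈ Finset.range i, w (0 + l)) * star (∏ l ∈ Finset.range j, w (0 + l)))⁻¹
  rwa [smul_smul, inv_mul_cancel₀ (mul_ne_zero (hprod i) (star_ne_zero.2 (hprod j))),
    one_smul] at h

end WeightedShift

end EllTwo

/-! ### Seminorms over compact sets -/

section SupSeminorms

variable {X : Type*} [TopologicalSpace X] {B : Type*} [CStarAlgebra B] {K : Set X}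

lemma norm_apply_le_supSeminorm (hK : IsCompact K) (f : C(X, B)) {x : X} (hx : x ∈ K) :
    ‖f x‖ ≤ supSeminorm K f :=
  le_csSup (hK.image (map_continuous f).norm).bddAbove (Set.mem_image_of_mem _ hx)

lemma supSeminorm_le {f : C(X, B)} {r : ℝ} (hr : 0 ≤ r) (h : ∀ x ∈ K, ‖f x‖ ≤ r) :
    supSeminorm K f ≤ r :=
  Real.sSup_le (by rintro _ ⟨x, hx, rfl⟩; exact h x hx) hr

/-- Continuous functions with values in a norm-closed set form a closed set for the seminorms of a
compact cover. -/
lemma seminormClosure_functionsInto_subset {K : ℕ → Set X} (hK : ∀ m, IsCompact (K m))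
    (hcov : ∀ x, ∃ m, x ∈ K m) {V : Set B} (hV : IsClosed V) :
    seminormClosure K (functionsInto X V) ⊆ functionsInto X V := by
  intro f hf x
  obtain ⟨m, hx⟩ := hcov x
  rw [← hV.closure_eq, Metric.mem_closure_iff]
  intro ε hε
  obtain ⟨g, hg, hfg⟩ := hf m ε hε
  refine ⟨g x, hg x, ?_⟩
  rw [dist_eq_norm]
  exact (norm_apply_le_supSeminorm (hK m) (f - g) hx).trans_lt hfg

variable [PartialOrder B] [StarOrderedRing B]

/-- Needed because the real `sSup` of an unbounded set is zero by convention. -/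
lemma bddAbove_norm_matrix_image (hK : IsCompact K) {n : ℕ}
    (f : Matrix (Fin n) (Fin n) C(X, B)) :
    BddAbove ((fun x => ‖CStarMatrix.ofMatrix (f.map fun h => h x)‖) '' K) := by
  have hcont : Continuous fun x => CStarMatrix.ofMatrix (f.map fun h => h x) :=
    continuous_pi fun i => continuous_pi fun j => map_continuous (f i j)
  exact (hK.image hcont.norm).bddAbove

/-- The quotient seminorm equals the original one if adding elements of the ideal does not
decrease the norms pointwise. -/
lemma quotientMatrixSeminorm_eq (hK : IsCompact K) {I : Set C(X, B)} (hI : 0 ∈ I) {n : ℕ}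
    (s : Matrix (Fin n) (Fin n) C(X, B))
    (h : ∀ g : Matrix (Fin n) (Fin n) C(X, B), (∀ i j, g i j ∈ I) → ∀ x ∈ K,
      ‖CStarMatrix.ofMatrix (s.map fun f => f x)‖ ≤
        ‖CStarMatrix.ofMatrix ((s + g).map fun f => f x)‖) :
    quotientMatrixSeminorm K I s = matrixSupSeminorm K s := by
  refine IsLeast.csInf_eq ⟨⟨0, fun _ _ => hI, by rw [add_zero]⟩, ?_⟩
  rintro _ ⟨g, hg, rfl⟩
  -- The nonnegativity of the bound covers an empty `K`.
  refine Real.sSup_le ?_ (Real.sSup_nonneg ?_)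
  · rintro _ ⟨x, hx, rfl⟩
    exact (h g hg x hx).trans
      (le_csSup (bddAbove_norm_matrix_image hK _) (Set.mem_image_of_mem _ hx))
  · rintro _ ⟨x, -, rfl⟩
    exact norm_nonneg _

end SupSeminorms

/-! ### Compact-valued functions in the generated algebra -/

section Adjoin

variable {X : Type*} [TopologicalSpace X] {B : Type*} [CStarAlgebra B]

/-- If `V` is a subspace containing the unit, the `*`-algebra generated by `C(X, V)` contains the
functions `x ↦ φ x • b` with `b` in the `*`-algebra generated by `V`. -/
lemma smul_const_mem_adjoin_functionsInto {V : Submodule ℂ B} (h1 : 1 ∈ V) (φ : C(X, ℂ)) {b : B}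
    (hb : b ∈ StarAlgebra.adjoin ℂ (V : Set B)) :
    φ • ContinuousMap.const X b ∈ StarAlgebra.adjoin ℂ (functionsInto X (V : Set B)) := by
  -- Since `V` contains the scalars, every scalar function is itself a generator.
  have hφ : φ • ContinuousMap.const X (1 : B) ∈
      StarAlgebra.adjoin ℂ (functionsInto X (V : Set B)) :=
    StarAlgebra.subset_adjoin ℂ _ fun x => V.smul_mem (φ x) h1
  have hconst : ContinuousMap.const X b ∈
      StarAlgebra.adjoin ℂ (functionsInto X (V : Set B)) := by
    induction hb using StarAlgebra.adjoin_induction with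
    | mem b hb => exact StarAlgebra.subset_adjoin ℂ _ fun _ => hb
    | algebraMap z => exact algebraMap_mem (StarAlgebra.adjoin ℂ (functionsInto X (V : Set B))) z
    | add a b _ _ ha hb => exact add_mem ha hb
    | mul a b _ _ ha hb => exact mul_mem ha hb
    | star a _ ha => exact star_mem ha
  have h := mul_mem hφ hconst
  convert h using 1
  ext1 x
  simp

end Adjoin

lemma isClosed_compactOperators : IsClosed compactOperators :=
  isClosed_setOfPred_isCompactOperator

/-- The compact-valued functions belong to the locally C*-algebra generated by `C(X, V)`, if all
matrix units belong to the `*`-algebra generated by `V`. -/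
lemma functionsInto_compactOperators_subset {X : Type*} [TopologicalSpace X] {K : ℕ → Set X}
    (hK : ∀ m, IsCompact (K m)) {S : EllTwo →L[ℂ] EllTwo} {N : ℕ} (hN : 0 < N)
    (hS : ∀ n, S (EllTwo.basisVector n) = EllTwo.basisVector (n + N))
    {V : Submodule ℂ (EllTwo →L[ℂ] EllTwo)} (h1 : 1 ∈ V)
    (hV : ∀ i j, EllTwo.matrixUnit i j ∈
      StarAlgebra.adjoin ℂ (V : Set (EllTwo →L[ℂ] EllTwo))) :
    functionsInto X compactOperators ⊆
      generatedLocalCStarAlgebra K (functionsInto X (V : Set (EllTwo →L[ℂ] EllTwo))) := by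
  intro f hf m ε hε
  have hcompact : IsCompact (f '' K m) := (hK m).image (map_continuous f)
  obtain ⟨k, hk⟩ := (EllTwo.isPureIsometry_shift hS hN).exists_corner_approximation hcompact
    (by rintro _ ⟨x, -, rfl⟩; exact hf x) (half_pos hε)
  -- The matrix coefficients of `f`, which depend continuously on the point.
  let φ : ℕ → ℕ → C(X, ℂ) := fun i j =>
    ⟨fun x => inner ℂ (EllTwo.basisVector i) (f x (EllTwo.basisVector j)), by fun_prop⟩
  refine ⟨∑ i ∈ Finset.range (k * N), ∑ j ∈ Finset.range (k * N),
    φ i j • ContinuousMap.const X (EllTwo.matrixUnit i j),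
    sum_mem fun i _ => sum_mem fun j _ => smul_const_mem_adjoin_functionsInto h1 _ (hV i j), ?_⟩
  refine (supSeminorm_le (half_pos hε).le fun x hx => ?_).trans_lt (half_lt_self hε)
  have hfx := hk (f x) (Set.mem_image_of_mem f hx)
  rw [EllTwo.corner_eq_sum hS] at hfx
  refine (congrArg norm ?_).trans_le hfx
  rw [ContinuousMap.sub_apply]
  simp only [ContinuousMap.sum_apply, ContinuousMap.smul_apply', ContinuousMap.const_apply, φ,
    ContinuousMap.coe_mk, EllTwo.inner_basisVector]

lemma one_mem_operatorSystemGenerated (W : EllTwo →L[ℂ] EllTwo) :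
    1 ∈ operatorSystemGenerated W :=
  Submodule.subset_span (by simp)

/-- An isometry commuting with `W` fixes the operator system of `W` under compression. -/
lemma compression_operatorSystemGenerated {V W : EllTwo →L[ℂ] EllTwo} (hV : star V * V = 1)
    (hVW : W * V = V * W) {T : EllTwo →L[ℂ] EllTwo} (hT : T ∈ operatorSystemGenerated W) :
    star V * T * V = T := by
  have hcomm : star V * W * V = W := by rw [mul_assoc, hVW, ← mul_assoc, hV, one_mul]
  induction hT using Submodule.span_induction with
  | mem T hT =>
    rcases hT with rfl | rfl | rfl
    · rw [mul_one, hV]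
    · exact hcomm
    · have h := congrArg star hcomm
      rwa [star_mul, star_mul, star_star, ← mul_assoc] at h
  | zero => rw [mul_zero, zero_mul]
  | add S T _ _ hS hT => rw [mul_add, add_mul, hS, hT]
  | smul z T _ hT => rw [mul_smul_comm, smul_mul_assoc, hT]

theorem mainTheorem7
    (F : ℕ ⥤ TopCat.{u}) [∀ m, CompactSpace (F.obj m)] [∀ m, T2Space (F.obj m)]
    (hF : ∀ (m n : ℕ) (h : m ⟶ n), Function.Injective (F.map h))
    (c : Cocone F) (hc : IsColimit c)
    (p : ℕ) (W : EllTwo →L[ℂ] EllTwo)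
    (hW : IsPeriodicUnilateralWeightedShift p W) (hirr : IsIrreducibleOperator W) :
    IsBoundaryIdeal (fun m => Set.range (c.ι.app m))
      (functionsInto c.pt (operatorSystemGenerated W : Set (EllTwo →L[ℂ] EllTwo)))
      (functionsInto c.pt compactOperators) := by
  obtain ⟨hp, w, hper, hWe⟩ := hW
  have hw := EllTwo.weights_ne_zero hWe hirr
  have hVe := EllTwo.normalized_weightedShift_pow_apply hWe hper hw
  have hV := EllTwo.isPureIsometry_shift hVe hp
  have hVW : W * ((∏ i ∈ Finset.range p, w i)⁻¹ • W ^ p) =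
      ((∏ i ∈ Finset.range p, w i)⁻¹ • W ^ p) * W := by
    rw [mul_smul_comm, smul_mul_assoc, ← pow_succ, ← pow_succ']
  have hK : ∀ m, IsCompact (Set.range (c.ι.app m)) := fun m =>
    isCompact_range (c.ι.app m).hom.continuous
  have hcov : ∀ x : c.pt, ∃ m, x ∈ Set.range (c.ι.app m) :=
    fun x => Concrete.isColimit_exists_rep F hc x
  refine ⟨?_, fun n m s hs => quotientMatrixSeminorm_eq (X := c.pt) (hK m)
    (I := functionsInto c.pt compactOperators) (fun _ => isCompactOperator_zero) s fun g hg x _ => ?_⟩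
  · refine
      { subset := functionsInto_compactOperators_subset hK hp hVe
          (one_mem_operatorSystemGenerated W) fun i j => ?_
        zero_mem := fun _ => isCompactOperator_zero
        add_mem := fun f hf g hg x => (hf x).add (hg x)
        smul_mem := fun z f hf x => (hf x).smul z
        mul_mem_left := fun a _ f hf x => (hf x).clm_comp (a x)
        mul_mem_right := fun a _ f hf x => (hf x).comp_clm (a x)
        star_mem := fun f hf x => hV.isCompactOperator_star (hf x)
        -- The stages cover the limit, so seminorm limits are pointwise norm limits, and the compact
        -- operators are norm closed.
        closed := Set.inter_subset_left.trans
          (seminormClosure_functionsInto_subset hK hcov isClosed_compactOperators) }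
    refine StarAlgebra.adjoin_mono ?_ (EllTwo.matrixUnit_mem_adjoin hWe hp hper hw i j)
    exact Set.singleton_subset_iff.2 (Submodule.subset_span (by simp))
  · exact hV.norm_le_norm_add_of_compact _ _
      (fun i j => compression_operatorSystemGenerated hV.star_mul_self hVW (hs i j x))
      fun i j => hg i j x
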